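/- Let $X$ be a real Hausdorff locally convex space, $X^*$ its topological dual with the weak-star topology, and $c(x,x^*)=\langle x,x^*\rangle$ on $X\times X^*$. A multivalued operator $T:X\rightrightarrows X^*$ has graph $\operatorname{Graph}T=\{(x,x^*): x^*\in Tx\}$, with which it is identified, and domain $D(T)=\{x: Tx\neq\emptyset\}$. For $S\subset X$, $T|_S$ is the operator with graph $\operatorname{Graph}T\cap(S\times X^*)$. The Fitzpatrick function of $T$ is $$\varphi_T(x,x^*)=\sup\{\langle x,u^*\rangle+\langle u,x^*\rangle-\langle u,u^*\rangle : (u,u^*)\in \operatorname{Graph}T\}\in[-\infty,+\infty],\qquad \sup\emptyset=-\infty,$$ and for a relation $\rho\in\{\le,=,\ge\}$ and a function $f$ on $X\times X^*$ we write $[f\,\rho\,c]=\{z: f(z)\,\rho\,c(z)\}$. For $S\subset X$: * $T$ is *$S$-NI* if $S\times X^*\subset[\varphi_{T|_S}\ge c]$; * $S$ *locates* $T$ if every $(x,x^*)\in[\varphi_{T|_S}\le c]\cap (S\times X^*)$ has $x\in D(T)$; * $S$ *identifies* $T$ if $[\varphi_{T|_S}\le c]\cap (S\times X^*)\subset\operatorname{Graph}T$;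 * $T$ is *$S$-representable* if $S\cap D(T)\neq\emptyset$ and there is a proper convex function $h:X\times X^*\to[-\infty,+\infty]$, lower semicontinuous for the product of the given topology of $X$ and the weak-star topology, with $h\ge c$ and $[h=c]\cap(S\times X^*)=\operatorname{Graph}(T|_S)$. For $C\subset X$ let $N_C(x)=\{x^*:\langle y-x,x^*\rangle\le 0\ \text{for all } y\in C\}$ if $x\in C$ and $N_C(x)=\emptyset$ otherwise, and let $(T+N_C)(x)=Tx+N_C(x)$ (Minkowski sum, empty if one summand is empty). **Proposition.** Let $T:X\rightrightarrows X^*$ and let $V\subset X$ be open and convex with $V\cap D(T)\neq\emptyset$ and $T|_V$ monotone. Suppose that $T$ is $V$-NI. Then $$\varphi_{T|_V}\ge c\quad\text{on }\overline V\times X^*,$$ and, for every $S$ with $V\subset S\subset\overline V$, $T$ is $S$-NI. If, in addition, $T$ is $\overline V$-representable, then $$[\varphi_{T|_V}\le c]\cap(\overline V\times X^*)\subset \operatorname{Graph}(T+N_{\overline V})\subset D(T)\times X^*,$$ and every $S$ with $V\subset S\subset\overline V$ locates $T$ and identifies $T+N_{\overline V}$. -/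

import Mathlib

open Set
open scoped Pointwise

noncomputable section

namespace LCSOp

/- `X` is a real topological vector space. Its topological dual `X*` carries the weak-star
topology, so it is `WeakDual ℝ X`, and `X × WeakDual ℝ X` carries the product topology `τ × ω*`.
A multivalued operator `T : X ⇉ X*` is a function `X → Set (WeakDual ℝ X)`. -/
variable {X : Type*} [AddCommGroup X] [Module ℝ X] [TopologicalSpace X]

/-- The coupling `c(x, x*) = ⟨x, x*⟩`. -/
def coupling (z : X × WeakDual ℝ X) : ℝ := z.2 z.1

/-- The natural pairing `z · w = ⟨x, u*⟩ + ⟨u, x*⟩` of `z = (x, x*)` and `w = (u, u*)`. -/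
def pairing (z w : X × WeakDual ℝ X) : ℝ := w.2 z.1 + z.2 w.1

/-- The graph `{(x, x*) | x* ∈ T x}`. -/
def graph (T : X → Set (WeakDual ℝ X)) : Set (X × WeakDual ℝ X) := {z | z.2 ∈ T z.1}

/-- The domain `D(T) = {x | T x ≠ ∅}`. -/
def dom (T : X → Set (WeakDual ℝ X)) : Set X := {x | (T x).Nonempty}

/-- The restriction `T|_V`, with graph `Graph T ∩ (V × X*)`. -/
def restrict (T : X → Set (WeakDual ℝ X)) (V : Set X) : X → Set (WeakDual ℝ X) :=
  fun x => {xs | x ∈ V ∧ xs ∈ T x}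

/-- The class `𝓜(X)` of monotone operators with nonempty graph. -/
def IsNonvoidMonotone (T : X → Set (WeakDual ℝ X)) : Prop :=
  (graph T).Nonempty ∧
    ∀ x₁ x₂ : X, ∀ y₁ ∈ T x₁, ∀ y₂ ∈ T x₂, 0 ≤ (y₁ - y₂) (x₁ - x₂)

/-- The Fitzpatrick function `φ_T(z) = sup {z · w - c(w) | w ∈ Graph T}`, with values in the
extended reals; the supremum of the empty set is `-∞`. -/
def fitzpatrick (T : X → Set (WeakDual ℝ X)) (z : X × WeakDual ℝ X) : EReal :=
  ⨆ w ∈ graph T, ((pairing z w - coupling w : ℝ) : EReal)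

/-- The set `[φ_T ≤ c]` of all points that are monotonically related to `T`. -/
def monoRelated (T : X → Set (WeakDual ℝ X)) : Set (X × WeakDual ℝ X) :=
  {z | fitzpatrick T z ≤ (coupling z : EReal)}

/-- `T` is of negative-infimum type on `V`: `V × X* ⊆ [φ_{T|_V} ≥ c]`. -/
def IsNI (T : X → Set (WeakDual ℝ X)) (V : Set X) : Prop :=
  V ×ˢ (univ : Set (WeakDual ℝ X)) ⊆ {z | (coupling z : EReal) ≤ fitzpatrick (restrict T V) z}

/-- `V` identifies `T`: `[φ_{T|_V} ≤ c] ∩ (V × X*) ⊆ Graph T`. -/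
def Identifies (V : Set X) (T : X → Set (WeakDual ℝ X)) : Prop :=
  monoRelated (restrict T V) ∩ V ×ˢ (univ : Set (WeakDual ℝ X)) ⊆ graph T

/-- `V` locates `T` in `S`: `Pr_X [φ_{T|_V} ≤ c] ∩ V ⊆ S`. -/
def LocatesIn (V : Set X) (T : X → Set (WeakDual ℝ X)) (S : Set X) : Prop :=
  Prod.fst '' monoRelated (restrict T V) ∩ V ⊆ S

/-- `V` locates `T`, that is, `V` locates `T` in `D(T)`. -/
def Locates (V : Set X) (T : X → Set (WeakDual ℝ X)) : Prop := LocatesIn V T (dom T)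

/-- The class `𝓡` of proper, convex, `τ × ω*`-lower semicontinuous extended-real functions `h` on
`X × X*` with `h ≥ c`. Convexity of `h` is convexity of its epigraph. -/
structure IsRepresentative (h : X × WeakDual ℝ X → EReal) : Prop where
  exists_lt_top : ∃ z, h z < ⊤
  ne_bot : ∀ z, h z ≠ ⊥
  convex_epigraph : Convex ℝ {p : (X × WeakDual ℝ X) × ℝ | h p.1 ≤ (p.2 : EReal)}
  lsc : LowerSemicontinuous h
  coupling_le : ∀ z, (coupling z : EReal) ≤ h z

/-- `T` is representable in `V`: `V ∩ D(T) ≠ ∅` and `[h = c] ∩ (V × X*) = Graph (T|_V)` for some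
`h` of class `𝓡`. -/
def IsRepresentableIn (T : X → Set (WeakDual ℝ X)) (V : Set X) : Prop :=
  (V ∩ dom T).Nonempty ∧
    ∃ h : X × WeakDual ℝ X → EReal, IsRepresentative h ∧
      {z | h z = (coupling z : EReal)} ∩ V ×ˢ (univ : Set (WeakDual ℝ X)) = graph (restrict T V)

/-- The normal cone operator `N_C`, the subdifferential of the indicator function of `C`:
`N_C(x) = {x* | ⟨y - x, x*⟩ ≤ 0 for all y ∈ C}` for `x ∈ C`, and `N_C(x) = ∅` for `x ∉ C`. -/
def normalCone (C : Set X) : X → Set (WeakDual ℝ X) :=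
  fun x => {xs | x ∈ C ∧ ∀ y ∈ C, xs (y - x) ≤ 0}

/-- The pointwise sum `(A + B) x = A x + B x` (Minkowski sum; empty if one summand is empty). -/
def opAdd (A B : X → Set (WeakDual ℝ X)) : X → Set (WeakDual ℝ X) := fun x => A x + B x

end LCSOp

end

open Filter Topology

namespace LCSOp

/-! ### Quadratic identities for the coupling; convexity of the Fitzpatrick function. -/

section Algebra

variable {X : Type*} [AddCommGroup X] [Module ℝ X] [TopologicalSpace X]

/-! Write φ for the Fitzpatrick function of `T|_V`. On a segment φ is convex and c is quadratic. A
segment from a point over the closure to a graph point of `T|_V` runs over the open set V, where NI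
applies; letting it shrink gives φ ≥ c over the closure. If also φ(z) ≤ c(z), then φ - c has a zero
minimum at z, and the first-order condition makes z a subgradient at z of φ plus the indicator of
the closure. Since V is open and meets the domain of φ, the sum rule splits off a normal n: z' = (x,
x* - n) satisfies z'·w - c(z') ≤ φ(w) for all w, i.e. φ*(z') ≤ c(z'). As φ* is the closed convex
hull of c restricted to the graph, any representative h lies below it, so h(z') = c(z') and x* - n ∈
Tx. -/

lemma pairing_comm (z w : X × WeakDual ℝ X) : pairing z w = pairing w z := by
  unfold pairing; ring

lemma pairing_smul_add_smul (a b : ℝ) (z w u : X × WeakDual ℝ X) :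
    pairing (a • z + b • w) u = a * pairing z u + b * pairing w u := by
  have h (f g : WeakDual ℝ X) (x : X) : (a • f + b • g) x = a * f x + b * g x := rfl
  simp only [pairing, Prod.fst_add, Prod.snd_add, Prod.smul_fst, Prod.smul_snd, map_add, map_smul,
    smul_eq_mul, h]
  ring

lemma coupling_smul_add_smul (a b : ℝ) (z w : X × WeakDual ℝ X) :
    coupling (a • z + b • w)
      = a ^ 2 * coupling z + a * b * pairing z w + b ^ 2 * coupling w := by
  have h (f g : WeakDual ℝ X) (x : X) : (a • f + b • g) x = a * f x + b * g x := rfl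
  simp only [pairing, coupling, Prod.fst_add, Prod.snd_add, Prod.smul_fst, Prod.smul_snd, map_add,
    map_smul, smul_eq_mul, h]
  ring

lemma pairing_self (z : X × WeakDual ℝ X) : pairing z z = 2 * coupling z := by
  unfold pairing coupling; ring

lemma fitzpatrick_le_coe_iff {T : X → Set (WeakDual ℝ X)} {z : X × WeakDual ℝ X} {r : ℝ} :
    fitzpatrick T z ≤ (r : EReal) ↔ ∀ w ∈ graph T, pairing z w - coupling w ≤ r := by
  simp only [fitzpatrick, iSup_le_iff, EReal.coe_le_coe_iff]

lemma fitzpatrick_mono {A B : X → Set (WeakDual ℝ X)} (h : graph A ⊆ graph B)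
    (z : X × WeakDual ℝ X) : fitzpatrick A z ≤ fitzpatrick B z :=
  biSup_mono fun _ hw => h hw

lemma graph_restrict_mono (T : X → Set (WeakDual ℝ X)) {V S : Set X} (h : V ⊆ S) :
    graph (restrict T V) ⊆ graph (restrict T S) :=
  fun _ hw => ⟨h hw.1, hw.2⟩

lemma IsNonvoidMonotone.fitzpatrick_le {A : X → Set (WeakDual ℝ X)} (hA : IsNonvoidMonotone A)
    {w : X × WeakDual ℝ X} (hw : w ∈ graph A) : fitzpatrick A w ≤ (coupling w : EReal) := by
  refine fitzpatrick_le_coe_iff.2 fun u hu => ?_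
  have h := hA.2 w.1 u.1 w.2 hw u.2 hu
  have e : (w.2 - u.2) (w.1 - u.1) = w.2 (w.1 - u.1) - u.2 (w.1 - u.1) := rfl
  rw [e, map_sub, map_sub] at h
  unfold pairing coupling
  linarith

lemma coe_le_fitzpatrick_iff {T : X → Set (WeakDual ℝ X)} {z : X × WeakDual ℝ X} {a : ℝ} :
    (a : EReal) ≤ fitzpatrick T z ↔ ∀ r : ℝ, fitzpatrick T z ≤ (r : EReal) → a ≤ r := by
  refine ⟨fun h r hr => EReal.coe_le_coe_iff.1 (h.trans hr), fun h => ?_⟩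
  by_contra! hlt
  obtain ⟨r, hr, hra⟩ := EReal.lt_iff_exists_real_btwn.1 hlt
  exact absurd (EReal.coe_lt_coe_iff.1 hra) (h r hr.le).not_gt

/-- Convexity of the Fitzpatrick function. -/
lemma fitzpatrick_smul_add_smul_le {T : X → Set (WeakDual ℝ X)} {z w : X × WeakDual ℝ X}
    {a b r s : ℝ} (ha : 0 ≤ a) (hb : 0 ≤ b) (hab : a + b = 1)
    (hz : fitzpatrick T z ≤ (r : EReal)) (hw : fitzpatrick T w ≤ (s : EReal)) :
    fitzpatrick T (a • z + b • w) ≤ ((a * r + b * s : ℝ) : EReal) := by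
  rw [fitzpatrick_le_coe_iff] at *
  intro u hu
  rw [pairing_smul_add_smul]
  have h1 := mul_le_mul_of_nonneg_left (hz u hu) ha
  have h2 := mul_le_mul_of_nonneg_left (hw u hu) hb
  have h3 : coupling u = a * coupling u + b * coupling u := by rw [← add_mul, hab, one_mul]
  linarith

end Algebra

/-- Segment inequalities are divided by t or 1 - t on the open interval; the endpoint is then
reached by continuity. -/
lemma le_of_forall_mem_Ioo_le {f g : ℝ → ℝ} (hf : Continuous f) (hg : Continuous g)
    (h : ∀ t ∈ Ioo (0 : ℝ) 1, f t ≤ g t) : f 0 ≤ g 0 := by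
  have : (0 : ℝ) ∈ closure (Ioo (0 : ℝ) 1) := by
    rw [closure_Ioo (by norm_num)]; simp
  exact closure_minimal (s := Ioo (0 : ℝ) 1) (t := {t | f t ≤ g t}) h (isClosed_le hf hg) this

/-! ### Passage to the closure and the subdifferential sum rule. -/

section Topological

variable {X : Type*} [AddCommGroup X] [Module ℝ X] [TopologicalSpace X]
  [IsTopologicalAddGroup X] [ContinuousSMul ℝ X]

/-- If `T` is `V`-NI, then `φ_{T|_V} ≥ c` on `closure V × X*`. -/
lemma IsNI.coupling_le_of_mem_closure {T : X → Set (WeakDual ℝ X)} {V : Set X}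
    (hNI : IsNI T V) (hVopen : IsOpen V) (hVconv : Convex ℝ V)
    (hmono : IsNonvoidMonotone (restrict T V)) {z : X × WeakDual ℝ X} (hz : z.1 ∈ closure V) :
    (coupling z : EReal) ≤ fitzpatrick (restrict T V) z := by
  refine coe_le_fitzpatrick_iff.2 fun r hr => ?_
  obtain ⟨w, hw⟩ := hmono.1
  -- This is c ≤ φ at (1 - t)z + tw, bounded by convexity and divided by 1 - t.
  have key := le_of_forall_mem_Ioo_le (f := fun t => (1 - t) * coupling z + t * pairing z w)
    (g := fun t => r + t * coupling w) (by fun_prop) (by fun_prop) fun t ht => ?_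
  · simpa using key
  · have hmem : ((1 - t) • z + t • w).1 ∈ V := by
      have := hVconv.combo_interior_closure_mem_interior (x := w.1) (y := z.1) (a := t)
        (b := 1 - t) (by rw [hVopen.interior_eq]; exact hw.1) hz ht.1 (by linarith [ht.2]) (by ring)
      rw [hVopen.interior_eq, add_comm] at this
      exact this
    have h1 : (coupling ((1 - t) • z + t • w) : EReal) ≤ _ :=
      hNI (show _ ∈ V ×ˢ univ from ⟨hmem, mem_univ _⟩)
    have h2 := fitzpatrick_smul_add_smul_le (a := 1 - t) (b := t) (by linarith [ht.2]) ht.1.le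
      (by ring) hr (hmono.fitzpatrick_le hw)
    have h3 := EReal.coe_le_coe_iff.1 (h1.trans h2)
    rw [coupling_smul_add_smul] at h3
    refine le_of_mul_le_mul_left ?_ (show 0 < 1 - t by linarith [ht.2])
    linear_combination h3

omit [IsTopologicalAddGroup X] [ContinuousSMul ℝ X] in
/-- If `φ_A ≥ c` on `C × X*` for a convex set `C` and `φ_A(z) ≤ c(z)` at a point `z` of `C × X*`,
then `z` is a subgradient of `φ_A` at `z` relative to `C × X*`. -/
lemma pairing_sub_coupling_le_of_mem {A : X → Set (WeakDual ℝ X)} {C : Set X} (hC : Convex ℝ C)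
    (hA : ∀ w : X × WeakDual ℝ X, w.1 ∈ C → (coupling w : EReal) ≤ fitzpatrick A w)
    {z w : X × WeakDual ℝ X} (hz : z ∈ monoRelated A) (hzC : z.1 ∈ C) (hwC : w.1 ∈ C) {r : ℝ}
    (hr : fitzpatrick A w ≤ (r : EReal)) : pairing z w - coupling z ≤ r := by
  -- The same comparison; the terms in c(z) now leave a factor t to divide by.
  have key := le_of_forall_mem_Ioo_le
    (f := fun t => - (1 - t) * coupling z + (1 - t) * pairing z w + t * coupling w)
    (g := fun _ => r) (by fun_prop) (by fun_prop) fun t ht => ?_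
  · simp only [sub_zero, zero_mul, one_mul, add_zero, neg_mul] at key
    linarith
  · have h1 := hA ((1 - t) • z + t • w)
      (hC hzC hwC (by linarith [ht.2]) ht.1.le (by ring))
    have h2 := fitzpatrick_smul_add_smul_le (a := 1 - t) (b := t) (by linarith [ht.2]) ht.1.le
      (by ring) hz hr
    have h3 := EReal.coe_le_coe_iff.1 (h1.trans h2)
    rw [coupling_smul_add_smul] at h3
    refine le_of_mul_le_mul_left ?_ ht.1
    linear_combination h3

/-- Subdifferential sum rule for a Fitzpatrick function and the indicator function of
`closure V × X*`, with `V` open and meeting the domain of the Fitzpatrick function. -/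
lemma exists_normalCone_forall_le {A : X → Set (WeakDual ℝ X)} {V : Set X}
    (hVopen : IsOpen V) (hVconv : Convex ℝ V)
    {w₀ : X × WeakDual ℝ X} (hw₀V : w₀.1 ∈ V) {r₀ : ℝ} (hw₀ : fitzpatrick A w₀ ≤ (r₀ : EReal))
    {z : X × WeakDual ℝ X} (hz : z ∈ monoRelated A) (hzV : z.1 ∈ closure V)
    (hsub : ∀ w : X × WeakDual ℝ X, w.1 ∈ V → ∀ r : ℝ, fitzpatrick A w ≤ (r : EReal) →
      pairing z w - coupling z ≤ r) :
    ∃ n ∈ normalCone (closure V) z.1, ∀ w : X × WeakDual ℝ X, ∀ r : ℝ,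
      fitzpatrick A w ≤ (r : EReal) →
        pairing (z.1, z.2 - n) w - coupling (z.1, z.2 - n) ≤ r := by
  -- Projecting out the dual variable makes the separating functional depend on X × ℝ only, so only
  -- the X* component of z gets corrected.
  let P : Set (X × ℝ) := {p | ∃ y : WeakDual ℝ X,
    fitzpatrick A (p.1, y) ≤ ((p.2 + (pairing z (p.1, y) - coupling z) : ℝ) : EReal)}
  have hP : Convex ℝ P := by
    rintro ⟨x₁, s₁⟩ ⟨y₁, h₁⟩ ⟨x₂, s₂⟩ ⟨y₂, h₂⟩ a b ha hb hab
    refine ⟨a • y₁ + b • y₂, ?_⟩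
    have h := fitzpatrick_smul_add_smul_le ha hb hab h₁ h₂
    have e : (((a • (x₁, s₁) + b • (x₂, s₂) : X × ℝ).1, a • y₁ + b • y₂) : X × WeakDual ℝ X)
      = a • (x₁, y₁) + b • (x₂, y₂) := rfl
    rw [e]
    refine h.trans_eq (congrArg _ ?_)
    simp only [pairing_comm z, pairing_smul_add_smul, Prod.snd_add, Prod.smul_snd, smul_eq_mul]
    linear_combination (-coupling z) * hab
  have hdisj : Disjoint (V ×ˢ Iio (0 : ℝ)) P := by
    rw [Set.disjoint_left]
    rintro ⟨x, s⟩ ⟨hx, hs⟩ ⟨y, hy⟩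
    have := hsub (x, y) hx _ hy
    simp only [mem_Iio] at hs this
    linarith
  obtain ⟨F, u, hF₁, hF₂⟩ := geometric_hahn_banach_open (hVconv.prod (convex_Iio 0))
    (hVopen.prod isOpen_Iio) hP hdisj
  let f : StrongDual ℝ X := F.comp (ContinuousLinearMap.inl ℝ X ℝ)
  have hF (x : X) (s : ℝ) : F (x, s) = f x + s * F (0, 1) := by
    have : ((x, s) : X × ℝ) = (x, 0) + s • (0, 1) := by simp
    rw [this, map_add, map_smul]; rfl
  set β := F (0, 1)
  have hmemP {w : X × WeakDual ℝ X} {r : ℝ} (h : fitzpatrick A w ≤ (r : EReal)) :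
      u ≤ f w.1 + (r - (pairing z w - coupling z)) * β := by
    rw [← hF]
    refine hF₂ _ ⟨w.2, ?_⟩
    simpa using h
  -- The hyperplane is not vertical: over `w₀.1` in V there are points on both sides.
  have hβpos : 0 < β := by
    by_contra! hle
    have h₁ := hmemP hw₀
    set q := r₀ - (pairing z w₀ - coupling z)
    have h₂ := hF₁ (w₀.1, -(|q| + 1)) ⟨hw₀V, by simp only [mem_Iio]; linarith [abs_nonneg q]⟩
    rw [hF] at h₂
    nlinarith [neg_abs_le q]
  have hV : ∀ x ∈ closure V, f x ≤ u := by
    refine closure_minimal (t := {x | f x ≤ u}) (fun x hx => ?_)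
      (isClosed_le f.continuous continuous_const)
    have := le_of_forall_mem_Ioo_le (f := fun t => f x + (-t) * β) (g := fun _ => u)
      (by fun_prop) (by fun_prop) fun t ht => by
        have := hF₁ (x, -t) ⟨hx, by simpa using ht.1⟩
        rw [hF] at this
        exact this.le
    simpa using this
  -- As φ(z) ≤ c(z), the point (`z.1`, 0) lies in `P`; hence f attains its maximum over the closure
  -- at `z.1`, and f/β is normal there.
  have hzu : u ≤ f z.1 := by
    have := hmemP (w := z) (r := coupling z) hz
    rw [pairing_self] at this
    linarith
  have hfz : f z.1 = u := le_antisymm (hV _ hzV) hzu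
  let n : WeakDual ℝ X := StrongDual.toWeakDual (β⁻¹ • f)
  have hn (x : X) : n x = β⁻¹ * f x := rfl
  refine ⟨n, ⟨hzV, fun y hy => ?_⟩, fun w r hr => ?_⟩
  · rw [hn, map_sub]
    have := hV y hy
    exact mul_nonpos_of_nonneg_of_nonpos (by positivity) (by linarith)
  · have h := hmemP hr
    have e (x : X) : (z.2 - n) x = z.2 x - β⁻¹ * f x := rfl
    have e₁ : pairing (z.1, z.2 - n) w = pairing z w - β⁻¹ * f w.1 := by
      simp only [pairing, e]; ring
    have e₂ : coupling (z.1, z.2 - n) = coupling z - β⁻¹ * u := by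
      simp only [coupling, e, hfz]
    rw [e₁, e₂]
    have h' := mul_le_mul_of_nonneg_left h (inv_nonneg.2 hβpos.le)
    rw [mul_add, mul_comm _ β, ← mul_assoc, inv_mul_cancel₀ hβpos.ne'] at h'
    linarith

/-! ### Duality on X × X* and recovery of the representative. -/

omit [IsTopologicalAddGroup X] [ContinuousSMul ℝ X] in
/-- Every continuous linear functional on `X × X*` is the pairing with some point of `X × X*`. -/
lemma exists_eq_pairing (F : StrongDual ℝ (X × WeakDual ℝ X)) :
    ∃ w : X × WeakDual ℝ X, ∀ y, F y = pairing w y := by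
  let f : StrongDual ℝ X := F.comp (ContinuousLinearMap.inl ℝ X (WeakDual ℝ X))
  let g : StrongDual ℝ (WeakDual ℝ X) := F.comp (ContinuousLinearMap.inr ℝ X (WeakDual ℝ X))
  obtain ⟨x, hx⟩ := LinearMap.dualEmbedding_surjective (topDualPairing ℝ X) g
  refine ⟨(x, StrongDual.toWeakDual f), fun y => ?_⟩
  have h₁ : F y = f y.1 + g y.2 := by
    change F y = F (y.1, 0) + F (0, y.2)
    rw [← map_add]; simp
  have h₂ : g y.2 = y.2 x := by rw [← hx]; rfl
  rw [h₁, h₂, add_comm]; rfl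

lemma isClosed_real_epigraph {E : Type*} [TopologicalSpace E] {h : E → EReal}
    (hh : LowerSemicontinuous h) : IsClosed {p : E × ℝ | h p.1 ≤ (p.2 : EReal)} :=
  (lowerSemicontinuous_iff_isClosed_epigraph.1 hh).preimage
    (f := fun p : E × ℝ => (p.1, (p.2 : EReal)))
    (continuous_fst.prodMk (continuous_coe_real_ereal.comp continuous_snd))

/-- A point with `φ(w) ≥ z · w - c(z)` for all `w` lies in `[h = c]` for every representative `h`
that agrees with `c` on a nonempty `A`
with proper Fitzpatrick function `φ`. -/
lemma IsRepresentative.eq_coupling [LocallyConvexSpace ℝ X] {h : X × WeakDual ℝ X → EReal}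
    (hh : IsRepresentative h) {A : X → Set (WeakDual ℝ X)} (hne : (graph A).Nonempty)
    (hA : ∀ w ∈ graph A, h w = (coupling w : EReal)) {w₁ : X × WeakDual ℝ X} {r₁ : ℝ}
    (hw₁ : fitzpatrick A w₁ ≤ (r₁ : EReal)) {z : X × WeakDual ℝ X}
    (hz : ∀ w : X × WeakDual ℝ X, ∀ r : ℝ, fitzpatrick A w ≤ (r : EReal) →
      pairing z w - coupling z ≤ r) : h z = (coupling z : EReal) := by
  refine le_antisymm ?_ (hh.coupling_le z)
  by_contra hlt
  have : LocallyConvexSpace ℝ (WeakDual ℝ X) :=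
    inferInstanceAs (LocallyConvexSpace ℝ (WeakBilin (topDualPairing ℝ X)))
  obtain ⟨F, u, hF₁, hF₂⟩ := geometric_hahn_banach_closed_point hh.convex_epigraph
    (isClosed_real_epigraph hh.lsc) (x := (z, coupling z)) hlt
  obtain ⟨w, hw⟩ := exists_eq_pairing (F.comp (ContinuousLinearMap.inl ℝ (X × WeakDual ℝ X) ℝ))
  have hF (y : X × WeakDual ℝ X) (s : ℝ) : F (y, s) = pairing w y + s * F (0, 1) := by
    have : ((y, s) : (X × WeakDual ℝ X) × ℝ) = (y, 0) + s • (0, 1) := by simp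
    rw [this, map_add, map_smul, ← hw]; rfl
  set β := F (0, 1)
  rw [hF] at hF₂
  have hgraph {y : X × WeakDual ℝ X} (hy : y ∈ graph A) {s : ℝ} (hs : coupling y ≤ s) :
      pairing w y + s * β < u := by
    rw [← hF]
    exact hF₁ (y, s) ((hA y hy).trans_le (EReal.coe_le_coe_iff.2 hs))
  have hβ : β ≤ 0 := by
    by_contra! hpos
    obtain ⟨y, hy⟩ := hne
    set q := u - pairing w y - coupling y * β
    have h₁ := hgraph hy (s := coupling y + |q| / β) (by linarith [div_nonneg (abs_nonneg q) hpos.le])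
    rw [add_mul, div_mul_cancel₀ _ hpos.ne'] at h₁
    linarith [le_abs_self q]
  rcases hβ.lt_or_eq with hneg | hzero
  -- Non-vertical case: φ(-w/β) ≤ -u/β, so the hypothesis at -w/β contradicts the separation. The
  -- zero summand only fits `pairing_smul_add_smul`.
  · have hσ : 0 < -β⁻¹ := by rw [neg_pos]; exact inv_lt_zero.2 hneg
    have hσβ : -β⁻¹ * β = -1 := by rw [neg_mul, inv_mul_cancel₀ hneg.ne]
    have hsmul (y : X × WeakDual ℝ X) :
        pairing ((-β⁻¹) • w + (0 : ℝ) • w) y = -β⁻¹ * pairing w y := by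
      rw [pairing_smul_add_smul, zero_mul, add_zero]
    have h₁ := hz ((-β⁻¹) • w + (0 : ℝ) • w) (-β⁻¹ * u) <| fitzpatrick_le_coe_iff.2 fun y hy => by
      have := mul_le_mul_of_nonneg_left (hgraph hy le_rfl).le hσ.le
      rw [hsmul]
      linear_combination this - coupling y * hσβ
    have h₂ := mul_lt_mul_of_pos_left hF₂ hσ
    rw [pairing_comm, hsmul] at h₁
    have h₃ : -β⁻¹ * (coupling z * β) = - coupling z := by linear_combination coupling z * hσβ
    rw [mul_add, h₃] at h₂
    linarith
  -- Vertical case: along w₁ + lw, φ grows at rate at most u, while the pairing with z grows at the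
  -- larger rate w·z; a large l is contradictory.
  · simp only [hzero, mul_zero, add_zero] at hgraph hF₂
    have hline (l : ℝ) (hl : 0 ≤ l) :
        pairing w₁ z + l * pairing w z - coupling z ≤ r₁ + l * u := by
      have h₁ := hz ((1 : ℝ) • w₁ + l • w) (r₁ + l * u) <| fitzpatrick_le_coe_iff.2 fun y hy => by
        have h₂ := mul_le_mul_of_nonneg_left (hgraph hy le_rfl).le hl
        have h₃ := fitzpatrick_le_coe_iff.1 hw₁ y hy
        rw [pairing_smul_add_smul]
        linarith
      rwa [pairing_comm, pairing_smul_add_smul, one_mul] at h₁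
    have hd : 0 < pairing w z - u := sub_pos.2 hF₂
    set q := r₁ + coupling z - pairing w₁ z
    have h₁ := hline ((|q| + 1) / (pairing w z - u)) (by positivity)
    have h₂ : (|q| + 1) / (pairing w z - u) * (pairing w z - u) = |q| + 1 :=
      div_mul_cancel₀ _ hd.ne'
    rw [mul_sub] at h₂
    linarith [le_abs_self q]

/-- If `T` is `V`-NI and `closure V`-representable, then `[φ_{T|_V} ≤ c] ∩ (closure V × X*)` is
contained in `Graph (T + N_{closure V})`. -/
lemma IsNI.monoRelated_inter_subset [LocallyConvexSpace ℝ X] {T : X → Set (WeakDual ℝ X)}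
    {V : Set X} (hNI : IsNI T V) (hVopen : IsOpen V) (hVconv : Convex ℝ V)
    (hmono : IsNonvoidMonotone (restrict T V)) (hrep : IsRepresentableIn T (closure V)) :
    monoRelated (restrict T V) ∩ closure V ×ˢ (univ : Set (WeakDual ℝ X)) ⊆
      graph (opAdd T (normalCone (closure V))) := by
  rintro z ⟨hz, hzV, -⟩
  obtain ⟨w₀, hw₀⟩ := hmono.1
  obtain ⟨-, h, hh, hhT⟩ := hrep
  obtain ⟨n, hn, hsub⟩ := exists_normalCone_forall_le hVopen hVconv hw₀.1
    (hmono.fitzpatrick_le hw₀) hz hzV fun w hw r hr =>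
      pairing_sub_coupling_le_of_mem hVconv.closure
        (fun w hw => hNI.coupling_le_of_mem_closure hVopen hVconv hmono hw)
        hz hzV (subset_closure hw) hr
  have hA : ∀ w ∈ graph (restrict T V), h w = (coupling w : EReal) := fun w hw => by
    have := graph_restrict_mono T subset_closure hw
    rw [← hhT] at this
    exact this.1
  have heq := hh.eq_coupling hmono.1 hA (hmono.fitzpatrick_le hw₀) hsub
  have hmem : (z.1, z.2 - n) ∈ graph (restrict T (closure V)) := by
    rw [← hhT]
    exact ⟨heq, hzV, mem_univ _⟩
  exact ⟨z.2 - n, hmem.2, n, hn, sub_add_cancel _ _⟩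

end Topological

end LCSOp

theorem proposition3p11 {X : Type*} [AddCommGroup X] [Module ℝ X] [TopologicalSpace X]
    [IsTopologicalAddGroup X] [ContinuousSMul ℝ X] [LocallyConvexSpace ℝ X] [T2Space X]
    (T : X → Set (WeakDual ℝ X)) (V : Set X)
    (hVopen : IsOpen V) (hVconv : Convex ℝ V)
    (hVT : (LCSOp.dom T ∩ V).Nonempty)
    (hmono : LCSOp.IsNonvoidMonotone (LCSOp.restrict T V))
    (hNI : LCSOp.IsNI T V) :
    (∀ z ∈ closure V ×ˢ (Set.univ : Set (WeakDual ℝ X)),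
        (LCSOp.coupling z : EReal) ≤ LCSOp.fitzpatrick (LCSOp.restrict T V) z) ∧
    (∀ S : Set X, V ⊆ S → S ⊆ closure V → LCSOp.IsNI T S) ∧
    (LCSOp.IsRepresentableIn T (closure V) →
      LCSOp.monoRelated (LCSOp.restrict T V) ∩ closure V ×ˢ (Set.univ : Set (WeakDual ℝ X)) ⊆
          LCSOp.graph (LCSOp.opAdd T (LCSOp.normalCone (closure V))) ∧
      LCSOp.graph (LCSOp.opAdd T (LCSOp.normalCone (closure V))) ⊆
          LCSOp.dom T ×ˢ (Set.univ : Set (WeakDual ℝ X)) ∧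
      ∀ S : Set X, V ⊆ S → S ⊆ closure V →
        LCSOp.Locates S T ∧
          LCSOp.Identifies S (LCSOp.opAdd T (LCSOp.normalCone (closure V)))) := by
  have hcl : ∀ z ∈ closure V ×ˢ (Set.univ : Set (WeakDual ℝ X)),
      (LCSOp.coupling z : EReal) ≤ LCSOp.fitzpatrick (LCSOp.restrict T V) z :=
    fun z hz => hNI.coupling_le_of_mem_closure hVopen hVconv hmono hz.1
  refine ⟨hcl, fun S hVS hSV z hz => ?_, fun hrep => ?_⟩
  · exact (hcl z ⟨hSV hz.1, hz.2⟩).trans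
      (LCSOp.fitzpatrick_mono (LCSOp.graph_restrict_mono T hVS) z)
  · have hsub := hNI.monoRelated_inter_subset hVopen hVconv hmono hrep
    have hdom : LCSOp.graph (LCSOp.opAdd T (LCSOp.normalCone (closure V))) ⊆
        LCSOp.dom T ×ˢ (Set.univ : Set (WeakDual ℝ X)) := by
      rintro z ⟨y, hy, -⟩
      exact ⟨⟨y, hy⟩, mem_univ _⟩
    refine ⟨hsub, hdom, fun S hVS hSV => ?_⟩
    -- Since 0 is a normal vector, enlarging the graph only raises φ and reduces the claim to V.
    have hle : LCSOp.graph (LCSOp.restrict T V) ⊆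
        LCSOp.graph (LCSOp.restrict (LCSOp.opAdd T (LCSOp.normalCone (closure V))) S) :=
      fun w hw => ⟨hVS hw.1, w.2, hw.2, 0, ⟨subset_closure hw.1, fun _ _ => le_rfl⟩, add_zero _⟩
    refine ⟨?_, fun z hz => hsub
      ⟨(LCSOp.fitzpatrick_mono hle z).trans hz.1, hSV hz.2.1, hz.2.2⟩⟩
    rintro _ ⟨⟨z, hz, rfl⟩, hzS⟩
    exact (hdom (hsub ⟨(LCSOp.fitzpatrick_mono (LCSOp.graph_restrict_mono T hVS) z).trans hz,
      hSV hzS, mem_univ _⟩)).1
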